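/- A packed matrix is a matrix with entries in $\mathbb{N}$ having no zero row and no zero column; the empty ($0\times 0$) matrix, denoted $1$, is packed. Let $\mathrm{Pack}$ be the set of packed matrices and let $\mathbf{H}_{\mathrm{Pack}}$ be the $\mathbb{Q}$-vector space with basis $\mathrm{Pack}$. Write $\mathrm{row}(M)$ and $\mathrm{col}(M)$ for the numbers of rows and columns of $M$, $[k]=\{1,\dots,k\}$, and $M\searrow M'=\begin{pmatrix}M&0\\0&M'\end{pmatrix}$. For a map $\alpha:[k]\to[l]$ let $\mu(\alpha)$ be the $l\times k$ matrix with $\mu(\alpha)_{i,j}=1$ if $i=\alpha(j)$ and $0$ otherwise. Let $\mathrm{qsh}(k,l)$ be the set of surjective maps $\sigma:[k+l]\to[n]$, for some $n$, with $\sigma(1)<\dots<\sigma(k)$ and $\sigma(k+1)<\dots<\sigma(k+l)$. Let $\mathrm{Adm}(k)$ be the set of pairs $(\sigma',\sigma'')$ of surjective maps $\sigma':[k]\to[k']$, $\sigma'':[k]\to[k'']$, for some $k',k''$, such that $\sigma'$ is weakly increasing and such that $i<j$ and $\sigma'(i)=\sigma'(j)$ imply $\sigma''(i)<\sigma''(j)$.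 For packed matrices $M,M'$ define, and extend (bi)linearly, $$M\sqcup\!\sqcup M'=\sum_{\substack{\sigma\in\mathrm{qsh}(\mathrm{row}(M),\mathrm{row}(M'))\\ \tau\in\mathrm{qsh}(\mathrm{col}(M),\mathrm{col}(M'))}}\mu(\sigma)(M\searrow M')\mu(\tau)^\top,\qquad \Delta(M)=\sum_{\substack{M',M''\in\mathrm{Pack}\\ M=M'\searrow M''}}M'\otimes M'',$$ $$\delta(M)=\sum_{\substack{(\sigma',\sigma'')\in\mathrm{Adm}(\mathrm{row}(M))\\ (\tau',\tau'')\in\mathrm{Adm}(\mathrm{col}(M))}}\mu(\sigma')M\mu(\tau')^\top\otimes\mu(\sigma'')M\mu(\tau'')^\top.$$ Let $\varepsilon_\Delta(M)=1$ if $M=1$ and $0$ otherwise, and let $\epsilon_\delta(M)=1$ if $M=1$ or if $M$ has exactly one row and one column, and $0$ otherwise. Theorem. $(\mathbf{H}_{\mathrm{Pack}},\sqcup\!\sqcup,\Delta,\delta)$ is a commutative double bialgebra, with unit $1$ and with counits $\varepsilon_\Delta$ of $\Delta$ and $\epsilon_\delta$ of $\delta$. That is, writing $m$ for the product $\sqcup\!\sqcup$: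 1. $(\mathbf{H}_{\mathrm{Pack}},m,\delta)$ is a commutative bialgebra with unit $1$ and counit $\epsilon_\delta$: $m$ is associative and commutative with unit $1$, $\delta$ is coassociative with counit $\epsilon_\delta$, and $\delta$ and $\epsilon_\delta$ are multiplicative and unital. 2. $(\mathbf{H}_{\mathrm{Pack}},m,\Delta)$ is a commutative bialgebra with unit $1$ and counit $\varepsilon_\Delta$, in the category of right comodules over $(\mathbf{H}_{\mathrm{Pack}},m,\delta)$, where the coaction on $\mathbf{H}_{\mathrm{Pack}}$ is $\delta$, the coaction on $\mathbf{H}_{\mathrm{Pack}}\otimes\mathbf{H}_{\mathrm{Pack}}$ is $(\mathrm{Id}\otimes\mathrm{Id}\otimes m)\circ(\mathrm{Id}\otimes c\otimes\mathrm{Id})\circ(\delta\otimes\delta)$ with $c$ the flip, and the coaction on $\mathbb{Q}$ is $r\mapsto r\otimes 1$: the product, the unit, $\Delta$ and $\varepsilon_\Delta$ are morphisms of comodules. In particular $$(\Delta\otimes\mathrm{Id})\circ\delta=(\mathrm{Id}\otimes\mathrm{Id}\otimes m)\circ(\mathrm{Id}\otimes c\otimes\mathrm{Id})\circ(\delta\otimes\delta)\circ\Delta,\qquad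 (\varepsilon_\Delta\otimes\mathrm{Id})\circ\delta(x)=\varepsilon_\Delta(x)\,1.$$ -/

import Mathlib

open scoped TensorProduct

/-! ### Commutative bialgebras and double bialgebras, given by structure maps -/

section DoubleBialgebra

variable {R A : Type*} [CommRing R] [AddCommGroup A] [Module R A]

/-- The componentwise product of `A ⊗ A`: `(a ⊗ b) · (a' ⊗ b') = m(a, a') ⊗ m(b, b')`. -/
noncomputable def tensorMul (m : A →ₗ[R] A →ₗ[R] A) :
    A ⊗[R] A →ₗ[R] A ⊗[R] A →ₗ[R] A ⊗[R] A :=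
  TensorProduct.map₂ m m

/-- `(A, m, Δ)`, with unit `e` and counit `ε`, is a commutative bialgebra over `R`. -/
structure IsCommBialgebra (m : A →ₗ[R] A →ₗ[R] A) (e : A)
    (Δ : A →ₗ[R] A ⊗[R] A) (ε : A →ₗ[R] R) : Prop where
  mul_assoc : ∀ a b c, m (m a b) c = m a (m b c)
  mul_comm : ∀ a b, m a b = m b a
  one_mul : ∀ a, m e a = a
  mul_one : ∀ a, m a e = a
  coassoc : (TensorProduct.assoc R A A A).toLinearMap ∘ₗ Δ.rTensor A ∘ₗ Δ = Δ.lTensor A ∘ₗ Δ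
  counit_left : ∀ a, ε.rTensor A (Δ a) = 1 ⊗ₜ[R] a
  counit_right : ∀ a, ε.lTensor A (Δ a) = a ⊗ₜ[R] 1
  comul_mul : ∀ a b, Δ (m a b) = tensorMul m (Δ a) (Δ b)
  comul_one : Δ e = e ⊗ₜ[R] e
  counit_mul : ∀ a b, ε (m a b) = ε a * ε b
  counit_one : ε e = 1

/-- The linear map `f : V → W` is a morphism for the right coactions `ρV` and `ρW` of `A`. -/
def IsComoduleHom {V W : Type*} [AddCommGroup V] [Module R V] [AddCommGroup W] [Module R W]
    (ρV : V →ₗ[R] V ⊗[R] A) (ρW : W →ₗ[R] W ⊗[R] A) (f : V →ₗ[R] W) : Prop :=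
  f.rTensor A ∘ₗ ρV = ρW ∘ₗ f

/-- The coaction of `(A, m)` on the tensor product of two right comodules:
`(Id ⊗ Id ⊗ m) ∘ (Id ⊗ c ⊗ Id) ∘ (ρV ⊗ ρW)`, where `c` is the flip. -/
noncomputable def tensorCoaction {V W : Type*} [AddCommGroup V] [Module R V]
    [AddCommGroup W] [Module R W] (m : A →ₗ[R] A →ₗ[R] A)
    (ρV : V →ₗ[R] V ⊗[R] A) (ρW : W →ₗ[R] W ⊗[R] A) :
    V ⊗[R] W →ₗ[R] (V ⊗[R] W) ⊗[R] A :=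
  (TensorProduct.lift m).lTensor (V ⊗[R] W) ∘ₗ
    (TensorProduct.tensorTensorTensorComm R V A W A).toLinearMap ∘ₗ
    TensorProduct.map ρV ρW

/-- The coaction `r ↦ r ⊗ e` of `A` on the ground ring, the unit object among comodules. -/
noncomputable def unitCoaction (e : A) : R →ₗ[R] R ⊗[R] A :=
  (TensorProduct.mk R R A).flip e

/-- `(A, m, Δ, δ)`, with unit `e` and counits `εΔ` and `εδ`, is a (commutative) double bialgebra:
`(A, m, δ)` is a commutative bialgebra, and `(A, m, Δ)` is a commutative bialgebra in the category
of right comodules over `(A, m, δ)`, with the coaction on `A` given by `δ` itself. -/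
structure IsDoubleBialgebra (m : A →ₗ[R] A →ₗ[R] A) (e : A)
    (Δ : A →ₗ[R] A ⊗[R] A) (εΔ : A →ₗ[R] R)
    (δ : A →ₗ[R] A ⊗[R] A) (εδ : A →ₗ[R] R) : Prop where
  bialgebra_δ : IsCommBialgebra m e δ εδ
  bialgebra_Δ : IsCommBialgebra m e Δ εΔ
  mul_comodule : IsComoduleHom (tensorCoaction m δ δ) δ (TensorProduct.lift m)
  unit_comodule : IsComoduleHom (unitCoaction e) δ (LinearMap.toSpanSingleton R A e)
  /-- `(Δ ⊗ Id) ∘ δ = (Id ⊗ Id ⊗ m) ∘ (Id ⊗ c ⊗ Id) ∘ (δ ⊗ δ) ∘ Δ` -/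
  comul_comodule : IsComoduleHom δ (tensorCoaction m δ δ) Δ
  /-- `(εΔ ⊗ Id) (δ a) = εΔ a ⊗ e` -/
  counit_comodule : IsComoduleHom δ (unitCoaction e) εΔ

end DoubleBialgebra

/-! ### Packed matrices -/

/-- A packed matrix: a matrix of natural numbers with no zero row and no zero column.
If one of `row`, `col` is zero then so is the other, which gives the empty matrix. -/
@[ext]
structure Pack where
  row : ℕ
  col : ℕ
  mat : Matrix (Fin row) (Fin col) ℕ
  row_ne : ∀ i, ∃ j, mat i j ≠ 0
  col_ne : ∀ j, ∃ i, mat i j ≠ 0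

namespace Pack

/-- The empty packed matrix. -/
def empty : Pack where
  row := 0
  col := 0
  mat := 0
  row_ne i := i.elim0
  col_ne j := j.elim0

/-- The block diagonal matrix `M ↘ M'`. -/
def blockDiag (M M' : Pack) : Pack where
  row := M.row + M'.row
  col := M.col + M'.col
  mat := Matrix.reindex finSumFinEquiv finSumFinEquiv (Matrix.fromBlocks M.mat 0 0 M'.mat)
  row_ne i := by
    obtain ⟨i, rfl⟩ := finSumFinEquiv.surjective i
    rcases i with i | i
    · obtain ⟨j, hj⟩ := M.row_ne i
      exact ⟨finSumFinEquiv (Sum.inl j), by simpa using hj⟩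
    · obtain ⟨j, hj⟩ := M'.row_ne i
      exact ⟨finSumFinEquiv (Sum.inr j), by simpa using hj⟩
  col_ne j := by
    obtain ⟨j, rfl⟩ := finSumFinEquiv.surjective j
    rcases j with j | j
    · obtain ⟨i, hi⟩ := M.col_ne j
      exact ⟨finSumFinEquiv (Sum.inl i), by simpa using hi⟩
    · obtain ⟨i, hi⟩ := M'.col_ne j
      exact ⟨finSumFinEquiv (Sum.inr i), by simpa using hi⟩

/-- The matrix `μ(α)` of a map `α : [k] → [l]`, with `μ(α) i j = 1` if `i = α j` and `0` otherwise. -/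
def mapMatrix {k l : ℕ} (α : Fin k → Fin l) : Matrix (Fin l) (Fin k) ℕ :=
  Matrix.of fun i j => if i = α j then 1 else 0

theorem mapMatrix_mul_mul_ne_zero {k l r c : ℕ} (N : Matrix (Fin k) (Fin l) ℕ)
    (σ : Fin k → Fin r) (τ : Fin l → Fin c) {i : Fin k} {j : Fin l} (h : N i j ≠ 0) :
    (mapMatrix σ * N * (mapMatrix τ).transpose) (σ i) (τ j) ≠ 0 := by
  rw [Matrix.mul_apply]
  intro h0
  have h1 := (Finset.sum_eq_zero_iff.mp h0) j (Finset.mem_univ _)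
  rw [Matrix.mul_apply] at h1
  simp only [mapMatrix, Matrix.transpose_apply, Matrix.of_apply, if_true, mul_one] at h1
  have h2 := (Finset.sum_eq_zero_iff.mp h1) i (Finset.mem_univ _)
  simp at h2
  exact h h2

/-- The packed matrix `μ(σ) M μ(τ)ᵀ`, for surjective maps `σ` and `τ`. -/
def contract (M : Pack) {r c : ℕ} (σ : Fin M.row → Fin r) (hσ : Function.Surjective σ)
    (τ : Fin M.col → Fin c) (hτ : Function.Surjective τ) : Pack where
  row := r
  col := c
  mat := mapMatrix σ * M.mat * (mapMatrix τ).transpose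
  row_ne i := by
    obtain ⟨i, rfl⟩ := hσ i
    obtain ⟨j, hj⟩ := M.row_ne i
    exact ⟨τ j, mapMatrix_mul_mul_ne_zero M.mat σ τ hj⟩
  col_ne j := by
    obtain ⟨j, rfl⟩ := hτ j
    obtain ⟨i, hi⟩ := M.col_ne j
    exact ⟨σ i, mapMatrix_mul_mul_ne_zero M.mat σ τ hi⟩

/-- The sum of the entries. -/
def weight (M : Pack) : ℕ := ∑ i, ∑ j, M.mat i j

theorem weight_blockDiag (M M' : Pack) : (M.blockDiag M').weight = M.weight + M'.weight := by
  unfold weight blockDiag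
  simp only
  rw [← finSumFinEquiv.sum_comp, Fintype.sum_sum_type]
  simp only [← finSumFinEquiv.sum_comp (fun j => Matrix.reindex _ _ _ _ j), Fintype.sum_sum_type]
  simp

theorem row_le_weight (M : Pack) : M.row ≤ M.weight := by
  calc M.row = ∑ _i : Fin M.row, 1 := by simp
    _ ≤ M.weight := Finset.sum_le_sum fun i _ => by
      obtain ⟨j, hj⟩ := M.row_ne i
      exact (Nat.one_le_iff_ne_zero.mpr hj).trans
        (Finset.single_le_sum (f := fun j => M.mat i j) (fun _ _ => Nat.zero_le _)
          (Finset.mem_univ j))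

theorem col_le_weight (M : Pack) : M.col ≤ M.weight := by
  calc M.col = ∑ _j : Fin M.col, 1 := by simp
    _ ≤ ∑ j, ∑ i, M.mat i j := Finset.sum_le_sum fun j _ => by
      obtain ⟨i, hi⟩ := M.col_ne j
      exact (Nat.one_le_iff_ne_zero.mpr hi).trans
        (Finset.single_le_sum (f := fun i => M.mat i j) (fun _ _ => Nat.zero_le _)
          (Finset.mem_univ i))
    _ = M.weight := Finset.sum_comm

theorem entry_le_weight (M : Pack) (i : Fin M.row) (j : Fin M.col) : M.mat i j ≤ M.weight :=
  (Finset.single_le_sum (f := fun j => M.mat i j) (fun _ _ => Nat.zero_le _)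
    (Finset.mem_univ j)).trans
    (Finset.single_le_sum (f := fun i => ∑ j, M.mat i j) (fun _ _ => Nat.zero_le _)
      (Finset.mem_univ i))

theorem finite_weight_le (n : ℕ) : {M : Pack | M.weight ≤ n}.Finite := by
  let T := Σ p : Fin (n + 1) × Fin (n + 1), (Fin p.1 → Fin p.2 → Fin (n + 1))
  let f : {M : Pack // M.weight ≤ n} → T := fun M =>
    ⟨(⟨M.1.row, Nat.lt_succ_of_le ((row_le_weight M.1).trans M.2)⟩,
      ⟨M.1.col, Nat.lt_succ_of_le ((col_le_weight M.1).trans M.2)⟩),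
      fun i j => ⟨M.1.mat i j, Nat.lt_succ_of_le ((entry_le_weight M.1 i j).trans M.2)⟩⟩
  have hf : Function.Injective f := by
    rintro ⟨⟨r, c, m, h1, h2⟩, h3⟩ ⟨⟨r', c', m', h1', h2'⟩, h3'⟩ h
    have h0 := Sigma.mk.inj_iff.mp h
    have hr : r = r' := congrArg (fun p => (p.1 : ℕ)) h0.1
    have hc : c = c' := congrArg (fun p => (p.2 : ℕ)) h0.1
    subst hr hc
    have hm := eq_of_heq h0.2
    have : m = m' := by
      ext i j
      exact congrArg Fin.val (congrFun (congrFun hm i) j)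
    subst this
    rfl
  exact Set.finite_coe_iff.mp (Finite.of_injective f hf)

/-- A packed matrix has finitely many decompositions `M = M' ↘ M''`. -/
theorem finite_blockDiag_eq (M : Pack) : {p : Pack × Pack | p.1.blockDiag p.2 = M}.Finite := by
  refine ((finite_weight_le M.weight).prod (finite_weight_le M.weight)).subset ?_
  rintro ⟨p, q⟩ h
  have h' : p.blockDiag q = M := h
  have hw := weight_blockDiag p q
  rw [h'] at hw
  exact ⟨show p.weight ≤ _ by omega, show q.weight ≤ _ by omega⟩

end Pack

/-- The set `qsh(k, l)` of quasi-shuffles: surjective maps `σ : [k + l] → [n]`, for some `n`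
(necessarily `n ≤ k + l`), with `σ(1) < ⋯ < σ(k)` and `σ(k + 1) < ⋯ < σ(k + l)`. -/
structure QuasiShuffle (k l : ℕ) where
  n : Fin (k + l + 1)
  map : Fin (k + l) → Fin n
  surj : Function.Surjective map
  strictMono_left : StrictMono fun i : Fin k => map (Fin.castAdd l i)
  strictMono_right : StrictMono fun j : Fin l => map (Fin.natAdd k j)

/-- The set `Adm(k)` of pairs of surjective maps `σ' : [k] → [k']` and `σ'' : [k] → [k'']`, for some
`k'` and `k''` (necessarily at most `k`), such that `σ'` is weakly increasing, and
`σ''(i) < σ''(j)` whenever `i < j` and `σ'(i) = σ'(j)`. -/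
structure Adm (k : ℕ) where
  n₁ : Fin (k + 1)
  n₂ : Fin (k + 1)
  map₁ : Fin k → Fin n₁
  map₂ : Fin k → Fin n₂
  surj₁ : Function.Surjective map₁
  surj₂ : Function.Surjective map₂
  mono₁ : Monotone map₁
  lt₂ : ∀ i j, i < j → map₁ i = map₁ j → map₂ i < map₂ j

instance (k l : ℕ) : Finite (QuasiShuffle k l) :=
  Finite.of_injective
    (fun s => (⟨s.n, s.map⟩ : Σ n : Fin (k + l + 1), (Fin (k + l) → Fin n)))
    (by rintro ⟨n, f, _, _, _⟩ ⟨n', f', _, _, _⟩ h; cases h; rfl)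

instance (k : ℕ) : Finite (Adm k) :=
  Finite.of_injective
    (fun s => (⟨(s.n₁, s.n₂), s.map₁, s.map₂⟩ :
      Σ n : Fin (k + 1) × Fin (k + 1), (Fin k → Fin n.1) × (Fin k → Fin n.2)))
    (by rintro ⟨n₁, n₂, f, g, _, _, _, _⟩ ⟨n₁', n₂', f', g', _, _, _, _⟩ h; cases h; rfl)

noncomputable instance (k l : ℕ) : Fintype (QuasiShuffle k l) := Fintype.ofFinite _

noncomputable instance (k : ℕ) : Fintype (Adm k) := Fintype.ofFinite _

/-! ### The double bialgebra of packed matrices -/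

/-- The `ℚ`-vector space with basis the set of packed matrices. -/
abbrev HPack : Type := Pack →₀ ℚ

namespace HPack

/-- The basis element of a packed matrix. -/
noncomputable def basis (M : Pack) : HPack := Finsupp.single M 1

/-- The product `M ⧢ M' = ∑ μ(σ) (M ↘ M') μ(τ)ᵀ`, over quasi-shuffles `σ` of the rows and `τ` of
the columns. -/
noncomputable def qsh : HPack →ₗ[ℚ] HPack →ₗ[ℚ] HPack :=
  Finsupp.linearCombination ℚ fun M : Pack =>
    Finsupp.linearCombination ℚ fun M' : Pack =>
      ∑ σ : QuasiShuffle M.row M'.row, ∑ τ : QuasiShuffle M.col M'.col,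
        basis ((M.blockDiag M').contract σ.map σ.surj τ.map τ.surj)

/-- The unit: the empty matrix. -/
noncomputable def one : HPack := basis Pack.empty

/-- The deconcatenation coproduct `Δ(M) = ∑ M' ⊗ M''`, over packed `M'`, `M''` with
`M = M' ↘ M''`. -/
noncomputable def Δ : HPack →ₗ[ℚ] HPack ⊗[ℚ] HPack :=
  Finsupp.linearCombination ℚ fun M : Pack =>
    ∑ p ∈ (Pack.finite_blockDiag_eq M).toFinset, basis p.1 ⊗ₜ[ℚ] basis p.2

open Classical in
/-- The counit of `Δ`: `1` on the empty matrix and `0` on all other packed matrices. -/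
noncomputable def εΔ : HPack →ₗ[ℚ] ℚ :=
  Finsupp.linearCombination ℚ fun M : Pack => if M = Pack.empty then (1 : ℚ) else 0

/-- The second coproduct `δ(M) = ∑ μ(σ') M μ(τ')ᵀ ⊗ μ(σ'') M μ(τ'')ᵀ`, over
`(σ', σ'') ∈ Adm(row M)` and `(τ', τ'') ∈ Adm(col M)`. -/
noncomputable def δ : HPack →ₗ[ℚ] HPack ⊗[ℚ] HPack :=
  Finsupp.linearCombination ℚ fun M : Pack =>
    ∑ σ : Adm M.row, ∑ τ : Adm M.col,
      basis (M.contract σ.map₁ σ.surj₁ τ.map₁ τ.surj₁) ⊗ₜ[ℚ]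
        basis (M.contract σ.map₂ σ.surj₂ τ.map₂ τ.surj₂)

open Classical in
/-- The counit of `δ`: `1` on the empty matrix and on the matrices with one row and one column,
and `0` on all other packed matrices. -/
noncomputable def εδ : HPack →ₗ[ℚ] ℚ :=
  Finsupp.linearCombination ℚ fun M : Pack =>
    if M = Pack.empty ∨ (M.row = 1 ∧ M.col = 1) then (1 : ℚ) else 0

end HPack

noncomputable instance OrderEmbedding.fintypeOfFinite (α β : Type*) [Preorder α] [Preorder β]
    [Finite α] [Finite β] : Fintype (α ↪o β) :=
  have : Finite (α ↪o β) := DFunLike.finite _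
  Fintype.ofFinite _

section ImageFactorization

variable {I : Type*} [LinearOrder I]

/-- Every map from `Fin k` factors as a surjection onto some `Fin n` followed by an increasing
map. -/
theorem Fin.exists_orderEmbedding_comp_surjective {k : ℕ} (F : Fin k → I) :
    ∃ n : Fin (k + 1), ∃ f : Fin n ↪o I, ∃ σ : Fin k → Fin n,
      Function.Surjective σ ∧ f ∘ σ = F := by
  classical
  set s := Finset.univ.image F
  have hs : s.card < k + 1 :=
    Nat.lt_succ_of_le (Finset.card_image_le.trans (by simp))
  refine ⟨⟨s.card, hs⟩, s.orderEmbOfFin rfl,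
    fun i => (s.orderIsoOfFin rfl).symm ⟨F i, Finset.mem_image_of_mem F (Finset.mem_univ i)⟩,
    fun j => ?_, ?_⟩
  · obtain ⟨i, -, hi⟩ := Finset.mem_image.mp (s.orderEmbOfFin_mem rfl j)
    refine ⟨i, ?_⟩
    rw [OrderIso.symm_apply_eq]
    exact Subtype.ext hi
  · funext i
    simp [Finset.orderEmbOfFin]

/-- The factorization of a map as a surjection followed by an increasing map is unique. -/
theorem Fin.orderEmbedding_comp_surjective_unique {k n n' : ℕ} {f : Fin n ↪o I} {f' : Fin n' ↪o I}
    {σ : Fin k → Fin n} {σ' : Fin k → Fin n'} (hσ : Function.Surjective σ)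
    (hσ' : Function.Surjective σ') (h : f ∘ σ = f' ∘ σ') :
    ∃ e : n = n', e ▸ f = f' ∧ e ▸ σ = σ' := by
  have hr : Set.range f = Set.range f' := by
    rw [← hσ.range_comp f, ← hσ'.range_comp f', h]
  have hn : n = n' := by
    have := congrArg Set.ncard hr
    rwa [← Set.image_univ, ← Set.image_univ, Set.ncard_image_of_injective _ f.injective,
      Set.ncard_image_of_injective _ f'.injective, Set.ncard_univ, Set.ncard_univ,
      Nat.card_fin, Nat.card_fin] at this
  subst hn
  have hf : f = f' :=
    DFunLike.coe_injective (StrictMono.range_inj f.strictMono f'.strictMono |>.mp hr)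
  subst hf
  exact ⟨rfl, rfl, funext fun i => f.injective (congrFun h i)⟩

end ImageFactorization

section Reindexing

variable {I J K : Type*} [LinearOrder I] [LinearOrder J] [Fintype I] [Fintype J] [AddCommMonoid K]

/-- The increasing maps out of the targets of the quasi-shuffles of `k` and `l` correspond to the
pairs of increasing maps out of `Fin k` and `Fin l`. -/
theorem QuasiShuffle.sum_comp (k l : ℕ) (h : (Fin (k + l) → I) → K) :
    ∑ s : QuasiShuffle k l, ∑ f : Fin s.n ↪o I, h (f ∘ s.map) =
      ∑ F : Fin k ↪o I, ∑ F' : Fin l ↪o I, h (Fin.append F F') := by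
  rw [← Fintype.sum_prod_type', ← Fintype.sum_sigma' (f := fun (s : QuasiShuffle k l)
    (f : Fin s.n ↪o I) => h (f ∘ s.map))]
  have happ : ∀ x : (Σ s : QuasiShuffle k l, Fin s.n ↪o I),
      Fin.append (fun i => x.2 (x.1.map (Fin.castAdd l i)))
        (fun i => x.2 (x.1.map (Fin.natAdd k i))) = x.2 ∘ x.1.map := fun x => by
    funext i
    refine Fin.addCases (fun i => ?_) (fun i => ?_) i <;> simp
  refine Fintype.sum_bijective (fun x =>
    (OrderEmbedding.ofStrictMono _ (x.2.strictMono.comp x.1.strictMono_left),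
      OrderEmbedding.ofStrictMono _ (x.2.strictMono.comp x.1.strictMono_right)))
    ⟨?_, ?_⟩ _ _ fun x => (congrArg h (happ x)).symm
  · rintro ⟨⟨n, σ, hσ, h1, h2⟩, f⟩ ⟨⟨n', σ', hσ', h1', h2'⟩, f'⟩ he
    have he1 := congrArg (fun p => Fin.append (p.1 : Fin k → I) (p.2 : Fin l → I)) he
    have he2 : f ∘ σ = f' ∘ σ' := ((happ _).symm.trans he1).trans (happ _)
    obtain ⟨e, e1, e2⟩ := Fin.orderEmbedding_comp_surjective_unique hσ hσ' he2
    obtain rfl := Fin.ext e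
    cases e1
    cases e2
    rfl
  · rintro ⟨F, F'⟩
    obtain ⟨n, f, σ, hσ, hf⟩ := Fin.exists_orderEmbedding_comp_surjective (Fin.append F F')
    have h1 : ∀ i, f (σ (Fin.castAdd l i)) = F i := fun i =>
      (congrFun hf _).trans (Fin.append_left _ _ i)
    have h2 : ∀ i, f (σ (Fin.natAdd k i)) = F' i := fun i =>
      (congrFun hf _).trans (Fin.append_right _ _ i)
    refine ⟨⟨⟨n, σ, hσ, fun i j hij => ?_, fun i j hij => ?_⟩, f⟩, ?_⟩
    · rw [← f.lt_iff_lt, h1, h1]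
      exact F.strictMono hij
    · rw [← f.lt_iff_lt, h2, h2]
      exact F'.strictMono hij
    · exact Prod.ext (DFunLike.ext _ _ h1) (DFunLike.ext _ _ h2)

/-- The pairs of increasing maps out of the targets of the admissible pairs on `Fin k` correspond to
the increasing maps from `Fin k` to a lexicographic product. -/
theorem Adm.sum_comp (k : ℕ) (h : (Fin k → I) → (Fin k → J) → K) :
    ∑ s : Adm k, ∑ f : Fin s.n₁ ↪o I, ∑ g : Fin s.n₂ ↪o J, h (f ∘ s.map₁) (g ∘ s.map₂) =
      ∑ F : Fin k ↪o I ×ₗ J, h (fun i => (ofLex (F i)).1) (fun i => (ofLex (F i)).2) := by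
  simp_rw [← Fintype.sum_prod_type']
  rw [← Fintype.sum_sigma' (f := fun (s : Adm k) (f : (Fin s.n₁ ↪o I) × (Fin s.n₂ ↪o J)) =>
    h (f.1 ∘ s.map₁) (f.2 ∘ s.map₂))]
  have hmono : ∀ x : (Σ s : Adm k, (Fin s.n₁ ↪o I) × (Fin s.n₂ ↪o J)),
      StrictMono fun i => toLex (x.2.1 (x.1.map₁ i), x.2.2 (x.1.map₂ i)) := fun x i j hij => by
    rw [Prod.Lex.toLex_lt_toLex]
    rcases (x.1.mono₁ hij.le).lt_or_eq with h1 | h1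
    · exact Or.inl (x.2.1.strictMono h1)
    · exact Or.inr ⟨congrArg x.2.1 h1, x.2.2.strictMono (x.1.lt₂ i j hij h1)⟩
  refine Fintype.sum_bijective (fun x => OrderEmbedding.ofStrictMono _ (hmono x))
    ⟨?_, ?_⟩ _ _ fun x => rfl
  · rintro ⟨⟨n₁, n₂, σ₁, σ₂, h1, h2, h3, h4⟩, f, g⟩
      ⟨⟨n₁', n₂', σ₁', σ₂', h1', h2', h3', h4'⟩, f', g'⟩ he
    have he1 : f ∘ σ₁ = f' ∘ σ₁' := funext fun i =>
      congrArg (fun F : Fin k ↪o I ×ₗ J => (ofLex (F i)).1) he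
    have he2 : g ∘ σ₂ = g' ∘ σ₂' := funext fun i =>
      congrArg (fun F : Fin k ↪o I ×ₗ J => (ofLex (F i)).2) he
    obtain ⟨e, e1, e2⟩ := Fin.orderEmbedding_comp_surjective_unique h1 h1' he1
    obtain ⟨d, d1, d2⟩ := Fin.orderEmbedding_comp_surjective_unique h2 h2' he2
    obtain rfl := Fin.ext e
    obtain rfl := Fin.ext d
    cases e1
    cases e2
    cases d1
    cases d2
    rfl
  · intro F
    obtain ⟨n₁, f, σ₁, hσ₁, hf⟩ :=
      Fin.exists_orderEmbedding_comp_surjective fun i => (ofLex (F i)).1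
    obtain ⟨n₂, g, σ₂, hσ₂, hg⟩ :=
      Fin.exists_orderEmbedding_comp_surjective fun i => (ofLex (F i)).2
    have hf' : ∀ i, f (σ₁ i) = (ofLex (F i)).1 := congrFun hf
    have hg' : ∀ i, g (σ₂ i) = (ofLex (F i)).2 := congrFun hg
    have hF : ∀ {i j}, i < j → (ofLex (F i)).1 < (ofLex (F j)).1 ∨
        (ofLex (F i)).1 = (ofLex (F j)).1 ∧ (ofLex (F i)).2 < (ofLex (F j)).2 := fun hij =>
      Prod.Lex.lt_iff.mp (F.strictMono hij)
    refine ⟨⟨⟨n₁, n₂, σ₁, σ₂, hσ₁, hσ₂, fun i j hij => ?_, fun i j hij he => ?_⟩, f, g⟩,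
      DFunLike.ext _ _ fun i => ?_⟩
    · rw [← f.le_iff_le, hf', hf']
      rcases hij.lt_or_eq with h1 | rfl
      · rcases hF h1 with h2 | h2
        exacts [h2.le, h2.1.le]
      · rfl
    · rw [← g.lt_iff_lt, hg', hg']
      rcases hF hij with h2 | h2
      · rw [← hf', ← hf', he] at h2
        exact absurd h2 (lt_irrefl _)
      · exact h2.2
    · exact congrArg toLex (Prod.ext (hf' i) (hg' i))

end Reindexing

section Append

variable {I J : Type*} [LinearOrder I] [LinearOrder J]

/-- The concatenation of increasing maps, to a lexicographic sum. -/
def OrderEmbedding.appendLex {a b : ℕ} (f : Fin a ↪o I) (g : Fin b ↪o J) :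
    Fin (a + b) ↪o I ⊕ₗ J :=
  OrderEmbedding.ofStrictMono
    (Fin.append (fun i => toLex (Sum.inl (f i))) (fun i => toLex (Sum.inr (g i)))) fun i j hij => by
      induction i using Fin.addCases with
      | left i =>
        induction j using Fin.addCases with
        | left j =>
          simp only [Fin.append_left]
          exact Sum.Lex.inl_lt_inl_iff.mpr (f.strictMono hij)
        | right j => simp
      | right i =>
        induction j using Fin.addCases with
        | left j =>
          simp only [Fin.lt_def, Fin.val_natAdd, Fin.val_castAdd] at hij
          omega
        | right j => simpa using hij

@[simp]
theorem OrderEmbedding.appendLex_castAdd {a b : ℕ} (f : Fin a ↪o I) (g : Fin b ↪o J) (i : Fin a) :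
    appendLex f g (Fin.castAdd b i) = toLex (Sum.inl (f i)) :=
  Fin.append_left (fun i => toLex (Sum.inl (f i))) (fun i => toLex (Sum.inr (g i))) i

@[simp]
theorem OrderEmbedding.appendLex_natAdd {a b : ℕ} (f : Fin a ↪o I) (g : Fin b ↪o J) (i : Fin b) :
    appendLex f g (Fin.natAdd a i) = toLex (Sum.inr (g i)) :=
  Fin.append_right (fun i => toLex (Sum.inl (f i))) (fun i => toLex (Sum.inr (g i))) i

/-- Every increasing map to a lexicographic sum is a concatenation. -/
theorem OrderEmbedding.exists_eq_appendLex {n : ℕ} (F : Fin n ↪o I ⊕ₗ J) :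
    ∃ (a b : ℕ) (e : n = a + b) (f : Fin a ↪o I) (g : Fin b ↪o J), e ▸ F = appendLex f g := by
  classical
  have hex : ∃ m, ∀ h : m < n, (ofLex (F ⟨m, h⟩)).isRight := ⟨n, fun h => absurd h (lt_irrefl n)⟩
  obtain ⟨b, hb⟩ : ∃ b, n = Nat.find hex + b :=
    Nat.exists_eq_add_of_le (Nat.find_min' hex fun h => absurd h (lt_irrefl n))
  have hspec := Nat.find_spec hex
  have hmin := fun m => Nat.find_min hex (m := m)
  generalize Nat.find hex = a at hb hspec hmin
  subst hb
  have hl : ∀ i : Fin a, ∃ x, F (Fin.castAdd b i) = toLex (Sum.inl x) := fun i => by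
    have := hmin i i.2
    push Not at this
    obtain ⟨h, h'⟩ := this
    exact (Sum.isLeft_iff.mp (Sum.not_isRight.mp h'))
  have hr : ∀ i : Fin b, ∃ x, F (Fin.natAdd a i) = toLex (Sum.inr x) := fun i => by
    have h0 : a < a + b := by have := i.2; omega
    obtain ⟨y, hy⟩ := Sum.isRight_iff.mp (hspec h0)
    have hle : F ⟨a, h0⟩ ≤ F (Fin.natAdd a i) := F.monotone (by simp [Fin.le_def])
    have hy' : F ⟨a, h0⟩ = toLex (Sum.inr y) := hy
    rw [hy'] at hle
    match hx : F (Fin.natAdd a i) with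
    | Sum.inr x => exact ⟨x, rfl⟩
    | Sum.inl x =>
      rw [hx] at hle
      exact absurd hle Sum.Lex.not_inr_le_inl
  choose f hf using hl
  choose g hg using hr
  refine ⟨a, b, rfl, OrderEmbedding.ofStrictMono f fun i j hij => ?_,
    OrderEmbedding.ofStrictMono g fun i j hij => ?_, DFunLike.ext _ _ fun i => ?_⟩
  · have h := F.strictMono (show Fin.castAdd b i < Fin.castAdd b j from hij)
    rwa [hf, hf, Sum.Lex.inl_lt_inl_iff] at h
  · have h := F.strictMono (show Fin.natAdd a i < Fin.natAdd a j from by simpa using hij)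
    rwa [hg, hg, Sum.Lex.inr_lt_inr_iff] at h
  · induction i using Fin.addCases with
    | left i => rw [appendLex_castAdd]; exact hf i
    | right i => rw [appendLex_natAdd]; exact hg i

/-- A concatenation determines its two parts. -/
theorem OrderEmbedding.appendLex_injective {a b a' b' : ℕ} {f : Fin a ↪o I} {g : Fin b ↪o J}
    {f' : Fin a' ↪o I} {g' : Fin b' ↪o J} {e : a + b = a' + b'}
    (h : ∀ i, appendLex f g i = appendLex f' g' (Fin.cast e i)) :
    ∃ (h1 : a = a') (h2 : b = b'), h1 ▸ f = f' ∧ h2 ▸ g = g' := by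
  have ha : a = a' := by
    by_contra hne
    rcases Nat.lt_or_gt_of_ne hne with hlt | hlt
    · have h1 := h (Fin.natAdd a ⟨0, by omega⟩)
      have h2 : Fin.cast e (Fin.natAdd a ⟨0, by omega⟩) = Fin.castAdd b' ⟨a, hlt⟩ :=
        Fin.ext (by simp)
      rw [h2, appendLex_castAdd, appendLex_natAdd] at h1
      simp at h1
    · have h1 := h (Fin.castAdd b ⟨a', hlt⟩)
      have h2 : Fin.cast e (Fin.castAdd b ⟨a', hlt⟩) = Fin.natAdd a' ⟨0, by omega⟩ :=
        Fin.ext (by simp)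
      rw [h2, appendLex_castAdd, appendLex_natAdd] at h1
      simp at h1
  subst ha
  have hb : b = b' := by omega
  subst hb
  refine ⟨rfl, rfl, DFunLike.ext _ _ fun i => ?_, DFunLike.ext _ _ fun i => ?_⟩
  · simpa using h (Fin.castAdd b i)
  · simpa using h (Fin.natAdd a i)

end Append

namespace Pack

variable {I J I' J' : Type}

/-- The value at `x` of the monomial with exponents `M`, where the rows and columns of `M` are
labelled by `F` and `G`. -/
def monomialEval (x : I → J → ℚ) (M : Pack) (F : Fin M.row → I) (G : Fin M.col → J) : ℚ :=
  ∏ i, ∏ j, x (F i) (G j) ^ M.mat i j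

theorem monomialEval_contract (x : I → J → ℚ) (M : Pack) {r c : ℕ} (σ : Fin M.row → Fin r)
    (hσ : Function.Surjective σ) (τ : Fin M.col → Fin c) (hτ : Function.Surjective τ)
    (f : Fin r → I) (g : Fin c → J) :
    (M.contract σ hσ τ hτ).monomialEval x f g = M.monomialEval x (f ∘ σ) (g ∘ τ) := by
  have hmat : ∀ i j, (mapMatrix σ * M.mat * (mapMatrix τ).transpose) i j =
      ∑ b, ∑ a, if j = τ b then if i = σ a then M.mat a b else 0 else 0 := fun i j => by
    simp only [Matrix.mul_apply, mapMatrix, Matrix.transpose_apply, Matrix.of_apply, ite_mul,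
      one_mul, zero_mul, mul_ite, mul_one, mul_zero]
    exact Finset.sum_congr rfl fun b _ => by split_ifs <;> simp
  change ∏ i : Fin r, ∏ j : Fin c,
    x (f i) (g j) ^ (mapMatrix σ * M.mat * (mapMatrix τ).transpose) i j = _
  simp_rw [hmat, ← Finset.prod_pow_eq_pow_sum]
  calc _ = ∏ i : Fin r, ∏ b, ∏ j : Fin c, ∏ a, x (f i) (g j) ^
          (if j = τ b then if i = σ a then M.mat a b else 0 else 0) :=
        Finset.prod_congr rfl fun i _ => Finset.prod_comm
    _ = ∏ i : Fin r, ∏ b, ∏ a, x (f i) (g (τ b)) ^ (if i = σ a then M.mat a b else 0) := by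
        refine Finset.prod_congr rfl fun i _ => Finset.prod_congr rfl fun b _ => ?_
        rw [Finset.prod_comm]
        refine Finset.prod_congr rfl fun a _ => ?_
        rw [Fintype.prod_eq_single (τ b) fun j hj => by rw [if_neg hj, pow_zero], if_pos rfl]
    _ = ∏ b, ∏ a, ∏ i : Fin r, x (f i) (g (τ b)) ^ (if i = σ a then M.mat a b else 0) := by
        rw [Finset.prod_comm]
        exact Finset.prod_congr rfl fun b _ => Finset.prod_comm
    _ = ∏ b, ∏ a, x (f (σ a)) (g (τ b)) ^ M.mat a b := by
        refine Finset.prod_congr rfl fun b _ => Finset.prod_congr rfl fun a _ => ?_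
        rw [Fintype.prod_eq_single (σ a) fun i hi => by rw [if_neg hi, pow_zero], if_pos rfl]
    _ = _ := Finset.prod_comm

theorem monomialEval_blockDiag_append (x : I → J → ℚ) (M M' : Pack) (F : Fin M.row → I)
    (F' : Fin M'.row → I) (G : Fin M.col → J) (G' : Fin M'.col → J) :
    (M.blockDiag M').monomialEval x (Fin.append F F') (Fin.append G G') =
      M.monomialEval x F G * M'.monomialEval x F' G' := by
  change ∏ i : Fin (M.row + M'.row), ∏ j : Fin (M.col + M'.col),
    x (Fin.append F F' i) (Fin.append G G' j) ^
      Matrix.fromBlocks M.mat 0 0 M'.mat (finSumFinEquiv.symm i) (finSumFinEquiv.symm j) = _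
  simp [Fin.prod_univ_add, monomialEval]

theorem monomialEval_mul (x : I → J → ℚ) (y : I' → J' → ℚ) (M : Pack) (F : Fin M.row → I ×ₗ I')
    (G : Fin M.col → J ×ₗ J') :
    M.monomialEval (fun i j => x (ofLex i).1 (ofLex j).1 * y (ofLex i).2 (ofLex j).2) F G =
      M.monomialEval x (fun i => (ofLex (F i)).1) (fun j => (ofLex (G j)).1) *
        M.monomialEval y (fun i => (ofLex (F i)).2) (fun j => (ofLex (G j)).2) := by
  simp [monomialEval, mul_pow, Finset.prod_mul_distrib]

end Pack

namespace HPack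

variable {I J I' J' : Type} [LinearOrder I] [Fintype I] [LinearOrder J] [Fintype J]
  [LinearOrder I'] [Fintype I'] [LinearOrder J'] [Fintype J']

/-- The value at `x` of the polynomial realization of packed matrices on the alphabets `I`
and `J`. -/
noncomputable def realize (x : I → J → ℚ) : HPack →ₗ[ℚ] ℚ :=
  Finsupp.linearCombination ℚ fun M : Pack =>
    ∑ F : Fin M.row ↪o I, ∑ G : Fin M.col ↪o J, M.monomialEval x F G

theorem realize_basis (x : I → J → ℚ) (M : Pack) :
    realize x (basis M) = ∑ F : Fin M.row ↪o I, ∑ G : Fin M.col ↪o J, M.monomialEval x F G := by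
  simp [realize, basis]

theorem hom_ext {V : Type*} [AddCommGroup V] [Module ℚ V] {f g : HPack →ₗ[ℚ] V}
    (h : ∀ M, f (basis M) = g (basis M)) : f = g :=
  Finsupp.lhom_ext' fun M => LinearMap.ext_ring (h M)

/-- The realization is multiplicative. -/
theorem realize_qsh (x : I → J → ℚ) (a b : HPack) :
    realize x (qsh a b) = realize x a * realize x b := by
  suffices h : qsh.compr₂ (realize x) = (LinearMap.mul ℚ ℚ).compl₁₂ (realize x) (realize x) from
    LinearMap.congr_fun₂ h a b
  refine hom_ext fun M => hom_ext fun M' => ?_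
  simp only [LinearMap.compr₂_apply, LinearMap.compl₁₂_apply, LinearMap.mul_apply', realize_basis]
  have h1 : qsh (basis M) (basis M') =
      ∑ σ : QuasiShuffle M.row M'.row, ∑ τ : QuasiShuffle M.col M'.col,
        basis ((M.blockDiag M').contract σ.map σ.surj τ.map τ.surj) := by
    simp [qsh, basis]
  obtain ⟨p, hp⟩ : ∃ p : (Fin (M.row + M'.row) → I) → (Fin (M.col + M'.col) → J) → ℚ,
      ∀ F G, p F G = (M.blockDiag M').monomialEval x F G := ⟨_, fun _ _ => rfl⟩
  have h2 : ∀ (σ : QuasiShuffle M.row M'.row) (τ : QuasiShuffle M.col M'.col),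
      realize x (basis ((M.blockDiag M').contract σ.map σ.surj τ.map τ.surj)) =
      ∑ F : Fin σ.n ↪o I, ∑ G : Fin τ.n ↪o J, p (F ∘ σ.map) (G ∘ τ.map) := fun σ τ => by
    rw [realize_basis]
    exact Finset.sum_congr rfl fun F _ => Finset.sum_congr rfl fun G _ =>
      (Pack.monomialEval_contract x _ _ σ.surj _ τ.surj _ _).trans (hp _ _).symm
  have h3 := fun F => QuasiShuffle.sum_comp M.col M'.col (p F)
  have h4 := QuasiShuffle.sum_comp M.row M'.row fun F : _ → I =>
    ∑ G : Fin M.col ↪o J, ∑ G' : Fin M'.col ↪o J, p F (Fin.append G G')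
  simp_rw [h1, map_sum, h2, Finset.sum_mul_sum]
  refine Eq.trans ?_ (h4.trans ?_)
  · refine Finset.sum_congr rfl fun σ _ => ?_
    rw [Finset.sum_comm]
    exact Finset.sum_congr rfl fun F _ => h3 _
  · exact Finset.sum_congr rfl fun F _ => Finset.sum_congr rfl fun F' _ =>
      Finset.sum_congr rfl fun G _ => Finset.sum_congr rfl fun G' _ =>
        (hp _ _).trans (Pack.monomialEval_blockDiag_append x M M' F F' G G')

theorem realize_one (x : I → J → ℚ) : realize x one = 1 := by
  rw [one, realize_basis]
  have h1 : Unique (Fin Pack.empty.row ↪o I) :=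
    { default := ⟨⟨Fin.elim0, fun i => i.elim0⟩, fun {i} => i.elim0⟩
      uniq := fun f => DFunLike.ext _ _ fun i => i.elim0 }
  have h2 : Unique (Fin Pack.empty.col ↪o J) :=
    { default := ⟨⟨Fin.elim0, fun i => i.elim0⟩, fun {i} => i.elim0⟩
      uniq := fun f => DFunLike.ext _ _ fun i => i.elim0 }
  rw [Fintype.sum_unique, Fintype.sum_unique]
  exact Fintype.prod_empty (ι := Fin 0) _

/-- The realization is invariant under isomorphisms of the alphabets. -/
theorem realize_congr (e : I ≃o I') (d : J ≃o J') {x : I → J → ℚ} {y : I' → J' → ℚ}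
    (h : ∀ i j, x i j = y (e i) (d j)) : realize x = realize y := by
  refine hom_ext fun M => ?_
  rw [realize_basis, realize_basis]
  refine Fintype.sum_equiv ((RelIso.refl _).relEmbeddingCongr e) _ _ fun F =>
    Fintype.sum_equiv ((RelIso.refl _).relEmbeddingCongr d) _ _ fun G => ?_
  exact Finset.prod_congr rfl fun i _ => Finset.prod_congr rfl fun j _ =>
    congrArg (· ^ M.mat i j) (h _ _)

/-- The evaluation of the tensor product of two linear forms. -/
noncomputable def tensorEval {V W : Type*} [AddCommGroup V] [Module ℚ V] [AddCommGroup W]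
    [Module ℚ W] (f : V →ₗ[ℚ] ℚ) (g : W →ₗ[ℚ] ℚ) : V ⊗[ℚ] W →ₗ[ℚ] ℚ :=
  TensorProduct.dualDistrib ℚ V W (f ⊗ₜ[ℚ] g)

theorem tensorEval_tmul {V W : Type*} [AddCommGroup V] [Module ℚ V] [AddCommGroup W]
    [Module ℚ W] (f : V →ₗ[ℚ] ℚ) (g : W →ₗ[ℚ] ℚ) (v : V) (w : W) :
    tensorEval f g (v ⊗ₜ w) = f v * g w :=
  TensorProduct.dualDistrib_apply f g v w

/-- The function of a product of alphabets realizing `δ`. -/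
def lexMul (x : I → J → ℚ) (y : I' → J' → ℚ) (i : I ×ₗ I') (j : J ×ₗ J') : ℚ :=
  x (ofLex i).1 (ofLex j).1 * y (ofLex i).2 (ofLex j).2

theorem tensorEval_δ (x : I → J → ℚ) (y : I' → J' → ℚ) (a : HPack) :
    tensorEval (realize x) (realize y) (δ a) = realize (lexMul x y) a := by
  suffices h : tensorEval (realize x) (realize y) ∘ₗ δ = realize (lexMul x y) from
    LinearMap.congr_fun h a
  refine hom_ext fun M => ?_
  have h1 : δ (basis M) = ∑ σ : Adm M.row, ∑ τ : Adm M.col,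
      basis (M.contract σ.map₁ σ.surj₁ τ.map₁ τ.surj₁) ⊗ₜ[ℚ]
        basis (M.contract σ.map₂ σ.surj₂ τ.map₂ τ.surj₂) := by
    simp [δ, basis]
  have h2 : ∀ (σ : Adm M.row) (τ : Adm M.col),
      realize x (basis (M.contract σ.map₁ σ.surj₁ τ.map₁ τ.surj₁)) *
        realize y (basis (M.contract σ.map₂ σ.surj₂ τ.map₂ τ.surj₂)) =
      ∑ F : Fin σ.n₁ ↪o I, ∑ F' : Fin σ.n₂ ↪o I', ∑ G : Fin τ.n₁ ↪o J, ∑ G' : Fin τ.n₂ ↪o J',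
        M.monomialEval x (F ∘ σ.map₁) (G ∘ τ.map₁) *
          M.monomialEval y (F' ∘ σ.map₂) (G' ∘ τ.map₂) := fun σ τ => by
    rw [realize_basis, realize_basis, Finset.sum_mul_sum]
    refine Finset.sum_congr rfl fun F _ => Finset.sum_congr rfl fun F' _ => ?_
    rw [Finset.sum_mul_sum]
    refine Finset.sum_congr rfl fun G _ => Finset.sum_congr rfl fun G' _ => ?_
    exact congrArg₂ (· * ·) (Pack.monomialEval_contract x _ _ σ.surj₁ _ τ.surj₁ _ _)
      (Pack.monomialEval_contract y _ _ σ.surj₂ _ τ.surj₂ _ _)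
  simp_rw [LinearMap.comp_apply, h1, map_sum, tensorEval_tmul, h2]
  have h3 := fun (F : Fin M.row → I) (F' : Fin M.row → I') =>
    Adm.sum_comp M.col fun (G : _ → J) (G' : _ → J') =>
      M.monomialEval x F G * M.monomialEval y F' G'
  have h4 := Adm.sum_comp M.row fun (F : _ → I) (F' : _ → I') =>
    ∑ G : Fin M.col ↪o J ×ₗ J', M.monomialEval x F (fun i => (ofLex (G i)).1) *
      M.monomialEval y F' (fun i => (ofLex (G i)).2)
  rw [realize_basis]
  refine Eq.trans ?_ (h4.trans ?_)
  · refine Finset.sum_congr rfl fun σ _ => ?_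
    rw [Finset.sum_comm]
    refine Finset.sum_congr rfl fun F _ => ?_
    rw [Finset.sum_comm]
    exact Finset.sum_congr rfl fun F' _ => h3 _ _
  · exact Finset.sum_congr rfl fun F _ => Finset.sum_congr rfl fun G _ =>
      (Pack.monomialEval_mul x y M F G).symm

end HPack

/-- The function on a sum of alphabets that is `x` and `y` on the diagonal blocks and `0`
elsewhere. -/
def lexAdd {I J I' J' : Type} (x : I → J → ℚ) (y : I' → J' → ℚ) (i : I ⊕ₗ I') (j : J ⊕ₗ J') : ℚ :=
  Sum.elim (fun i => Sum.elim (x i) (fun _ => 0) (ofLex j))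
    (fun i => Sum.elim (fun _ => 0) (y i) (ofLex j)) (ofLex i)

namespace Pack

variable {I J I' J' : Type} [LinearOrder I] [LinearOrder J] [LinearOrder I'] [LinearOrder J']

theorem monomialEval_blockDiag_lexAdd (x : I → J → ℚ) (y : I' → J' → ℚ) (M M' : Pack)
    (F : Fin M.row ↪o I) (F' : Fin M'.row ↪o I') (G : Fin M.col ↪o J) (G' : Fin M'.col ↪o J') :
    (M.blockDiag M').monomialEval (lexAdd x y) (OrderEmbedding.appendLex F F')
      (OrderEmbedding.appendLex G G') = M.monomialEval x F G * M'.monomialEval y F' G' :=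
  monomialEval_blockDiag_append (lexAdd x y) M M' (fun i => toLex (Sum.inl (F i)))
    (fun i => toLex (Sum.inr (F' i))) (fun i => toLex (Sum.inl (G i)))
    (fun i => toLex (Sum.inr (G' i)))

/-- A labelling of `M` by sums of alphabets with nonzero value comes from a block
decomposition of `M`. -/
theorem exists_blockDiag_of_monomialEval_ne_zero (x : I → J → ℚ) (y : I' → J' → ℚ) (M : Pack)
    (F : Fin M.row ↪o I ⊕ₗ I') (G : Fin M.col ↪o J ⊕ₗ J')
    (hne : M.monomialEval (lexAdd x y) F G ≠ 0) :
    ∃ (p q : Pack) (h : p.blockDiag q = M) (f : Fin p.row ↪o I) (f' : Fin q.row ↪o I')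
      (g : Fin p.col ↪o J) (g' : Fin q.col ↪o J'),
      (Fin.castOrderIso (congrArg row h).symm).toOrderEmbedding.trans
          (OrderEmbedding.appendLex f f') = F ∧
        (Fin.castOrderIso (congrArg col h).symm).toOrderEmbedding.trans
          (OrderEmbedding.appendLex g g') = G := by
  obtain ⟨r, c, m, hr, hc⟩ := M
  dsimp only at F G
  obtain ⟨a, b, rfl, f, f', rfl⟩ := OrderEmbedding.exists_eq_appendLex F
  obtain ⟨a', b', rfl, g, g', rfl⟩ := OrderEmbedding.exists_eq_appendLex G
  have h0 : ∀ i j, m i j ≠ 0 → lexAdd x y (OrderEmbedding.appendLex f f' i)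
      (OrderEmbedding.appendLex g g' j) ≠ 0 := fun i j hm h => by
    refine hne (Finset.prod_eq_zero (Finset.mem_univ i) (Finset.prod_eq_zero (Finset.mem_univ j) ?_))
    exact (congrArg (· ^ m i j) h).trans (zero_pow hm)
  have h12 : ∀ i j, m (Fin.castAdd b i) (Fin.natAdd a' j) = 0 := fun i j => by
    by_contra h
    refine h0 _ _ h ?_
    rw [OrderEmbedding.appendLex_castAdd, OrderEmbedding.appendLex_natAdd]
    rfl
  have h21 : ∀ i j, m (Fin.natAdd a i) (Fin.castAdd b' j) = 0 := fun i j => by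
    by_contra h
    refine h0 _ _ h ?_
    rw [OrderEmbedding.appendLex_castAdd, OrderEmbedding.appendLex_natAdd]
    rfl
  have hm : ∀ i j, Matrix.fromBlocks (fun i j => m (Fin.castAdd b i) (Fin.castAdd b' j)) 0 0
      (fun i j => m (Fin.natAdd a i) (Fin.natAdd a' j)) (finSumFinEquiv.symm i)
      (finSumFinEquiv.symm j) = m i j := fun i j => by
    induction i using Fin.addCases with
    | left i =>
      induction j using Fin.addCases with
      | left j => simp only [finSumFinEquiv_symm_apply_castAdd]; rfl
      | right j =>
        rw [finSumFinEquiv_symm_apply_castAdd, finSumFinEquiv_symm_apply_natAdd, h12]; rfl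
    | right i =>
      induction j using Fin.addCases with
      | left j =>
        rw [finSumFinEquiv_symm_apply_castAdd, finSumFinEquiv_symm_apply_natAdd, h21]; rfl
      | right j => simp only [finSumFinEquiv_symm_apply_natAdd]; rfl
  refine ⟨⟨a, a', fun i j => m (Fin.castAdd b i) (Fin.castAdd b' j), fun i => ?_, fun j => ?_⟩,
    ⟨b, b', fun i j => m (Fin.natAdd a i) (Fin.natAdd a' j), fun i => ?_, fun j => ?_⟩, ?_,
    f, f', g, g', ?_, ?_⟩
  · obtain ⟨j, hj⟩ := hr (Fin.castAdd b i)
    induction j using Fin.addCases with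
    | left j => exact ⟨j, hj⟩
    | right j => exact absurd (h12 i j) hj
  · obtain ⟨i, hi⟩ := hc (Fin.castAdd b' j)
    induction i using Fin.addCases with
    | left i => exact ⟨i, hi⟩
    | right i => exact absurd (h21 i j) hi
  · obtain ⟨j, hj⟩ := hr (Fin.natAdd a i)
    induction j using Fin.addCases with
    | left j => exact absurd (h21 i j) hj
    | right j => exact ⟨j, hj⟩
  · obtain ⟨i, hi⟩ := hc (Fin.natAdd a' j)
    induction i using Fin.addCases with
    | left i => exact absurd (h12 i j) hi
    | right i => exact ⟨i, hi⟩
  · unfold blockDiag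
    congr 1
    ext i j
    exact hm i j
  · rfl
  · rfl

/-- A block decomposition is determined by its block sizes. -/
theorem blockDiag_injective {p q p' q' : Pack} (h : p.blockDiag q = p'.blockDiag q')
    (hr : p.row = p'.row) (hc : p.col = p'.col) (hr' : q.row = q'.row) (hc' : q.col = q'.col) :
    p = p' ∧ q = q' := by
  obtain ⟨r, c, m, _, _⟩ := p
  obtain ⟨r', c', m', _, _⟩ := q
  obtain ⟨_, _, n, _, _⟩ := p'
  obtain ⟨_, _, n', _, _⟩ := q'
  dsimp only at hr hc hr' hc'
  subst hr hc hr' hc'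
  simp only [blockDiag, Pack.mk.injEq, heq_eq_eq, true_and] at h
  have h' := (Matrix.reindex finSumFinEquiv finSumFinEquiv).injective h
  obtain ⟨h1, -, -, h2⟩ := Matrix.fromBlocks_inj.mp h'
  subst h1 h2
  exact ⟨rfl, rfl⟩

end Pack

namespace HPack

variable {I J I' J' : Type} [LinearOrder I] [Fintype I] [LinearOrder J] [Fintype J]
  [LinearOrder I'] [Fintype I'] [LinearOrder J'] [Fintype J']

theorem tensorEval_Δ (x : I → J → ℚ) (y : I' → J' → ℚ) (a : HPack) :
    tensorEval (realize x) (realize y) (Δ a) = realize (lexAdd x y) a := by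
  suffices h : tensorEval (realize x) (realize y) ∘ₗ Δ = realize (lexAdd x y) from
    LinearMap.congr_fun h a
  refine hom_ext fun M => ?_
  have h1 : Δ (basis M) =
      ∑ p ∈ (Pack.finite_blockDiag_eq M).toFinset, basis p.1 ⊗ₜ[ℚ] basis p.2 := by
    simp [Δ, basis]
  have h2 : ∀ p q : Pack, realize x (basis p) * realize y (basis q) =
      ∑ s : ((Fin p.row ↪o I) × (Fin q.row ↪o I')) × ((Fin p.col ↪o J) × (Fin q.col ↪o J')),
        p.monomialEval x s.1.1 s.2.1 * q.monomialEval y s.1.2 s.2.2 := fun p q => by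
    simp_rw [realize_basis, Fintype.sum_prod_type, Finset.sum_mul_sum]
  simp_rw [LinearMap.comp_apply, h1, map_sum, tensorEval_tmul, h2]
  rw [realize_basis, Finset.sum_sigma', ← Fintype.sum_prod_type']
  have hS : ∀ {s : Σ p : Pack × Pack, ((Fin p.1.row ↪o I) × (Fin p.2.row ↪o I')) ×
      ((Fin p.1.col ↪o J) × (Fin p.2.col ↪o J'))},
    s ∈ ((Pack.finite_blockDiag_eq M).toFinset.sigma fun _ => Finset.univ) ↔
      s.1.1.blockDiag s.1.2 = M := by simp
  refine Finset.sum_bij_ne_zero (fun s hs _ =>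
    ((Fin.castOrderIso (congrArg Pack.row (hS.mp hs)).symm).toOrderEmbedding.trans
        (OrderEmbedding.appendLex s.2.1.1 s.2.1.2),
      (Fin.castOrderIso (congrArg Pack.col (hS.mp hs)).symm).toOrderEmbedding.trans
        (OrderEmbedding.appendLex s.2.2.1 s.2.2.2)))
    (fun _ _ _ => Finset.mem_univ _) ?_ ?_ ?_
  · rintro ⟨⟨p, q⟩, ⟨f, f'⟩, g, g'⟩ hs - ⟨⟨p', q'⟩, ⟨e, e'⟩, d, d'⟩ hs' - he
    have h := hS.mp hs
    have h' := hS.mp hs'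
    dsimp only at h h'
    subst h
    obtain ⟨he1, he2⟩ := Prod.mk.inj he
    obtain ⟨a1, a2, b1, b2⟩ := OrderEmbedding.appendLex_injective
      (e := (congrArg Pack.row h').symm) fun i => DFunLike.congr_fun he1 i
    obtain ⟨c1, c2, d1, d2⟩ := OrderEmbedding.appendLex_injective
      (e := (congrArg Pack.col h').symm) fun i => DFunLike.congr_fun he2 i
    obtain ⟨rfl, rfl⟩ := Pack.blockDiag_injective h' a1.symm c1.symm a2.symm c2.symm
    cases b1
    cases b2
    cases d1
    cases d2
    rfl
  · rintro ⟨F, G⟩ - hne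
    obtain ⟨p, q, h, f, f', g, g', rfl, rfl⟩ :=
      Pack.exists_blockDiag_of_monomialEval_ne_zero x y M F G hne
    refine ⟨⟨(p, q), (f, f'), g, g'⟩, hS.mpr h, ?_, rfl⟩
    subst h
    rw [← Pack.monomialEval_blockDiag_lexAdd]
    exact hne
  · rintro ⟨⟨p, q⟩, ⟨f, f'⟩, g, g'⟩ hs -
    have h := hS.mp hs
    dsimp only at h
    subst h
    exact (Pack.monomialEval_blockDiag_lexAdd x y p q f f' g g').symm

end HPack

/-- A family of linear forms that separates points. -/
def IsSeparating {ι V : Type*} [AddCommGroup V] [Module ℚ V] (f : ι → V →ₗ[ℚ] ℚ) : Prop :=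
  ∀ v w, (∀ i, f i v = f i w) → v = w

theorem IsSeparating.tensorEval {ι κ V W : Type*} [AddCommGroup V] [Module ℚ V] [AddCommGroup W]
    [Module ℚ W] {f : ι → V →ₗ[ℚ] ℚ} {g : κ → W →ₗ[ℚ] ℚ} (hf : IsSeparating f)
    (hg : IsSeparating g) : IsSeparating fun i : ι × κ => HPack.tensorEval (f i.1) (g i.2) := by
  classical
  intro s t h
  let b := Module.Basis.ofVectorSpace ℚ V
  apply (TensorProduct.equivFinsuppOfBasisLeft b).injective
  ext i
  rw [TensorProduct.equivFinsuppOfBasisLeft_apply, TensorProduct.equivFinsuppOfBasisLeft_apply]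
  have hleft : ∀ (φ : V →ₗ[ℚ] ℚ) (k : κ) (u : V ⊗[ℚ] W),
      g k (TensorProduct.lid ℚ W (φ.rTensor W u)) = HPack.tensorEval φ (g k) u := fun φ k u => by
    suffices h : g k ∘ₗ (TensorProduct.lid ℚ W).toLinearMap ∘ₗ φ.rTensor W =
      HPack.tensorEval φ (g k) from LinearMap.congr_fun h u
    ext v w
    simp [HPack.tensorEval_tmul]
  have hright : ∀ (φ : V →ₗ[ℚ] ℚ) (k : κ) (u : V ⊗[ℚ] W),
      φ (TensorProduct.rid ℚ V ((g k).lTensor V u)) = HPack.tensorEval φ (g k) u := fun φ k u => by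
    suffices h : φ ∘ₗ (TensorProduct.rid ℚ V).toLinearMap ∘ₗ (g k).lTensor V =
      HPack.tensorEval φ (g k) from LinearMap.congr_fun h u
    ext v w
    simp [HPack.tensorEval_tmul, mul_comm]
  refine hg _ _ fun k => ?_
  rw [hleft, hleft, ← hright, ← hright]
  refine congrArg _ (hf _ _ fun j => ?_)
  rw [hright, hright]
  exact h (j, k)

theorem isSeparating_id : IsSeparating fun _ : Unit => (LinearMap.id : ℚ →ₗ[ℚ] ℚ) :=
  fun _ _ h => h ()

instance Fin.subsingleton_orderEmbedding (n : ℕ) : Subsingleton (Fin n ↪o Fin n) where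
  allEq f g := by
    have hf := Finite.surjective_of_injective f.injective
    have hg := Finite.surjective_of_injective g.injective
    exact DFunLike.coe_injective
      ((f.strictMono.range_inj g.strictMono).mp (hf.range_eq.trans hg.range_eq.symm))

/-- If a packed matrix `M` is obtained by inserting zero rows and columns in a packed matrix `N`,
then `N = M`. -/
theorem Pack.eq_of_pushforward_eq {M N : Pack} (F : Fin N.row ↪o Fin M.row)
    (G : Fin N.col ↪o Fin M.col)
    (h : ∑ i, ∑ j, Finsupp.single (F i, G j) (N.mat i j) =
      ∑ i, ∑ j, Finsupp.single (i, j) (M.mat i j)) : N = M := by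
  classical
  have hM : ∀ a b, (∑ i, ∑ j, Finsupp.single (F i, G j) (N.mat i j)) (a, b) = M.mat a b := by
    intro a b
    rw [h]
    simp only [Finsupp.finsetSum_apply, Finsupp.single_apply, Prod.mk.injEq]
    rw [Finset.sum_eq_single a, Finset.sum_eq_single b] <;> simp +contextual
  have hpos : ∀ a b, M.mat a b ≠ 0 → ∃ i j, F i = a ∧ G j = b := by
    intro a b hab
    rw [← hM, Finsupp.finsetSum_apply] at hab
    obtain ⟨i, -, hi⟩ := Finset.exists_ne_zero_of_sum_ne_zero hab
    rw [Finsupp.finsetSum_apply] at hi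
    obtain ⟨j, -, hj⟩ := Finset.exists_ne_zero_of_sum_ne_zero hi
    rw [Finsupp.single_apply] at hj
    have := (ite_ne_right_iff.mp hj).1
    exact ⟨i, j, congrArg Prod.fst this, congrArg Prod.snd this⟩
  have hF : Function.Surjective F := fun a => by
    obtain ⟨b, hb⟩ := M.row_ne a
    obtain ⟨i, _, hi, _⟩ := hpos a b hb
    exact ⟨i, hi⟩
  have hG : Function.Surjective G := fun b => by
    obtain ⟨a, ha⟩ := M.col_ne b
    obtain ⟨_, j, _, hj⟩ := hpos a b ha
    exact ⟨j, hj⟩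
  obtain ⟨r, c, m, hr, hc⟩ := N
  obtain ⟨r', c', m', hr', hc'⟩ := M
  dsimp only at F G hM hF hG
  obtain rfl : r = r' := by
    simpa using Fintype.card_of_bijective ⟨F.injective, hF⟩
  obtain rfl : c = c' := by
    simpa using Fintype.card_of_bijective ⟨G.injective, hG⟩
  obtain rfl : F = RelEmbedding.refl _ := Subsingleton.elim _ _
  obtain rfl : G = RelEmbedding.refl _ := Subsingleton.elim _ _
  congr 1
  ext a b
  rw [← hM]
  simp only [Finsupp.finsetSum_apply, Finsupp.single_apply, Prod.mk.injEq, RelEmbedding.refl_apply]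
  rw [Finset.sum_eq_single a, Finset.sum_eq_single b] <;> simp +contextual

namespace HPack

/-- The realizations on finite alphabets `Fin n` and `Fin m` separate points. -/
theorem isSeparating_realize :
    IsSeparating fun x : Σ p : ℕ × ℕ, (Fin p.1 → Fin p.2 → ℚ) => realize x.2 := by
  classical
  intro v w h
  rw [← sub_eq_zero]
  set a := v - w with ha
  have h0 : ∀ (n m : ℕ) (x : Fin n → Fin m → ℚ), realize x a = 0 := fun n m x => by
    rw [ha, map_sub, sub_eq_zero]
    exact h ⟨(n, m), x⟩
  clear_value a
  ext M
  let e : ∀ N : Pack, (Fin N.row ↪o Fin M.row) → (Fin N.col ↪o Fin M.col) →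
    (Fin M.row × Fin M.col →₀ ℕ) := fun N F G => ∑ i, ∑ j, Finsupp.single (F i, G j) (N.mat i j)
  let P : MvPolynomial (Fin M.row × Fin M.col) ℚ :=
    ∑ N ∈ a.support, ∑ F : Fin N.row ↪o Fin M.row, ∑ G : Fin N.col ↪o Fin M.col,
      MvPolynomial.monomial (e N F G) (a N)
  have hP : P = 0 := MvPolynomial.funext fun x => by
    rw [map_zero, ← h0 _ _ fun i j => x (i, j)]
    simp only [P, map_sum, realize, Finsupp.linearCombination_apply, Finsupp.sum, smul_eq_mul,
      Finset.mul_sum]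
    refine Finset.sum_congr rfl fun N _ => Finset.sum_congr rfl fun F _ =>
      Finset.sum_congr rfl fun G _ => ?_
    rw [MvPolynomial.eval_monomial]
    congr 1
    simp only [e, Pack.monomialEval]
    rw [← Finsupp.prod_finsetSum_index (by simp) (by simp [pow_add])]
    refine Finset.prod_congr rfl fun i _ => ?_
    rw [← Finsupp.prod_finsetSum_index (by simp) (by simp [pow_add])]
    refine Finset.prod_congr rfl fun j _ => ?_
    rw [Finsupp.prod_single_index (by simp)]
  have hc : MvPolynomial.coeff (∑ i, ∑ j, Finsupp.single (i, j) (M.mat i j)) P = a M := by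
    simp only [P, MvPolynomial.coeff_sum, MvPolynomial.coeff_monomial]
    rw [Finset.sum_eq_single M]
    · rw [Fintype.sum_eq_single (RelEmbedding.refl _), Fintype.sum_eq_single (RelEmbedding.refl _)]
      · exact if_pos rfl
      · exact fun G hG => absurd ((Fin.subsingleton_orderEmbedding _).elim _ _) hG
      · exact fun F hF => absurd ((Fin.subsingleton_orderEmbedding _).elim _ _) hF
    · exact fun N _ hN => Finset.sum_eq_zero fun F _ => Finset.sum_eq_zero fun G _ =>
        if_neg fun he => hN (Pack.eq_of_pushforward_eq F G he)
    · intro hM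
      simp [Finsupp.notMem_support_iff.mp hM]
  rw [hP, MvPolynomial.coeff_zero] at hc
  exact hc.symm

end HPack

namespace Pack

theorem eq_empty_of_row_eq_zero {M : Pack} (h : M.row = 0) : M = empty := by
  obtain ⟨r, c, m, hr, hc⟩ := M
  dsimp only at h
  subst h
  obtain rfl : c = 0 := by
    by_contra hne
    obtain ⟨i, -⟩ := hc ⟨0, Nat.pos_of_ne_zero hne⟩
    exact i.elim0
  unfold empty
  congr 1
  ext i
  exact i.elim0

theorem eq_empty_of_col_eq_zero {M : Pack} (h : M.col = 0) : M = empty := by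
  refine eq_empty_of_row_eq_zero ?_
  by_contra hne
  obtain ⟨j, -⟩ := M.row_ne ⟨0, Nat.pos_of_ne_zero hne⟩
  rw [h] at j
  exact j.elim0

end Pack

namespace HPack

section Counits

variable {I J I' J' : Type} [LinearOrder I] [Fintype I] [LinearOrder J] [Fintype J]
  [LinearOrder I'] [Fintype I'] [LinearOrder J'] [Fintype J']

/-- The counit of `Δ` is the realization on empty alphabets. -/
theorem realize_of_isEmpty [IsEmpty I] [IsEmpty J] (x : I → J → ℚ) : realize x = εΔ := by
  classical
  refine hom_ext fun M => ?_
  have h1 : εΔ (basis M) = if M = Pack.empty then (1 : ℚ) else 0 := by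
    simp [εΔ, basis]
  rw [h1]
  split_ifs with h
  · subst h
    exact realize_one x
  · rw [realize_basis]
    have : Nonempty (Fin M.row) :=
      Fin.pos_iff_nonempty.mp (Nat.pos_of_ne_zero fun h0 => h (Pack.eq_empty_of_row_eq_zero h0))
    have : IsEmpty (Fin M.row ↪o I) := ⟨fun F => isEmptyElim (F (Classical.arbitrary _))⟩
    exact Fintype.sum_empty _

/-- The counit of `δ` is the realization at the constant `1` on alphabets with one letter. -/
theorem realize_unit : realize (fun _ _ : Unit => 1) = εδ := by
  classical
  refine hom_ext fun M => ?_
  have h1 : εδ (basis M) = if M = Pack.empty ∨ (M.row = 1 ∧ M.col = 1) then (1 : ℚ) else 0 := by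
    simp [εδ, basis]
  have hle : ∀ {n : ℕ}, (Fin n ↪o Unit) → n ≤ 1 := fun F => by
    simpa using Fintype.card_le_of_injective F F.injective
  have hM : ∀ (F : Fin M.row → Unit) (G : Fin M.col → Unit),
      M.monomialEval (fun _ _ : Unit => 1) F G = 1 := fun F G => by simp [Pack.monomialEval]
  have hone : ∀ {n : ℕ}, n = 1 → Fintype.card (Fin n ↪o Unit) = 1 := fun hn => by
    subst hn
    exact Fintype.card_eq_one_iff.mpr
      ⟨OrderEmbedding.ofStrictMono (fun _ => ()) fun i j hij => by omega,
        fun F => DFunLike.ext _ _ fun _ => rfl⟩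
  rw [h1]
  split_ifs with h
  · rcases h with rfl | ⟨hr, hc⟩
    · exact realize_one _
    · rw [realize_basis]
      simp_rw [hM]
      simp [hone hr, hone hc]
  · rw [realize_basis]
    refine Finset.sum_eq_zero fun F _ => Finset.sum_eq_zero fun G _ => absurd ?_ h
    have h2 := hle F
    have h3 := hle G
    by_cases hr : M.row = 0
    · exact Or.inl (Pack.eq_empty_of_row_eq_zero hr)
    · by_cases hc : M.col = 0
      · exact Or.inl (Pack.eq_empty_of_col_eq_zero hc)
      · exact Or.inr (by omega)

end Counits

section TensorEval

variable {V W U V' : Type*} [AddCommGroup V] [Module ℚ V] [AddCommGroup W] [Module ℚ W]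
  [AddCommGroup U] [Module ℚ U] [AddCommGroup V'] [Module ℚ V']

theorem tensorEval_rTensor (f : V' →ₗ[ℚ] ℚ) (g : W →ₗ[ℚ] ℚ) (h : V →ₗ[ℚ] V') (t : V ⊗[ℚ] W) :
    tensorEval f g (h.rTensor W t) = tensorEval (f ∘ₗ h) g t := by
  suffices H : tensorEval f g ∘ₗ h.rTensor W = tensorEval (f ∘ₗ h) g from LinearMap.congr_fun H t
  ext v w
  simp [tensorEval_tmul]

theorem tensorEval_lTensor (f : W →ₗ[ℚ] ℚ) (g : V' →ₗ[ℚ] ℚ) (h : V →ₗ[ℚ] V') (t : W ⊗[ℚ] V) :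
    tensorEval f g (h.lTensor W t) = tensorEval f (g ∘ₗ h) t := by
  suffices H : tensorEval f g ∘ₗ h.lTensor W = tensorEval f (g ∘ₗ h) from LinearMap.congr_fun H t
  ext v w
  simp [tensorEval_tmul]

theorem tensorEval_assoc (f : V →ₗ[ℚ] ℚ) (g : W →ₗ[ℚ] ℚ) (h : U →ₗ[ℚ] ℚ) (t : (V ⊗[ℚ] W) ⊗[ℚ] U) :
    tensorEval f (tensorEval g h) (TensorProduct.assoc ℚ V W U t) =
      tensorEval (tensorEval f g) h t := by
  suffices H : tensorEval f (tensorEval g h) ∘ₗ (TensorProduct.assoc ℚ V W U).toLinearMap =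
    tensorEval (tensorEval f g) h from LinearMap.congr_fun H t
  ext v w u
  simp [tensorEval_tmul, mul_assoc]

theorem tensorEval_tensorMul {m : V →ₗ[ℚ] V →ₗ[ℚ] V} {f g : V →ₗ[ℚ] ℚ}
    (hf : ∀ a b, f (m a b) = f a * f b) (hg : ∀ a b, g (m a b) = g a * g b) (s t : V ⊗[ℚ] V) :
    tensorEval f g (tensorMul m s t) = tensorEval f g s * tensorEval f g t := by
  suffices H : (tensorMul m).compr₂ (tensorEval f g) =
    (LinearMap.mul ℚ ℚ).compl₁₂ (tensorEval f g) (tensorEval f g) from LinearMap.congr_fun₂ H s t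
  ext a b c d
  simp [tensorEval_tmul, tensorMul, hf, hg, mul_mul_mul_comm]

theorem tensorEval_tensorCoaction {m : U →ₗ[ℚ] U →ₗ[ℚ] U} (ρV : V →ₗ[ℚ] V ⊗[ℚ] U)
    (ρW : W →ₗ[ℚ] W ⊗[ℚ] U) (f : V →ₗ[ℚ] ℚ) (g : W →ₗ[ℚ] ℚ) {h : U →ₗ[ℚ] ℚ}
    (hh : ∀ a b, h (m a b) = h a * h b) (t : V ⊗[ℚ] W) :
    tensorEval (tensorEval f g) h (tensorCoaction m ρV ρW t) =
      tensorEval (tensorEval f h ∘ₗ ρV) (tensorEval g h ∘ₗ ρW) t := by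
  have key : ∀ (s : V ⊗[ℚ] U) (s' : W ⊗[ℚ] U),
      tensorEval (tensorEval f g) h ((TensorProduct.lift m).lTensor (V ⊗[ℚ] W)
        (TensorProduct.tensorTensorTensorComm ℚ V U W U (s ⊗ₜ s'))) =
      tensorEval f h s * tensorEval g h s' := fun s s' => by
    suffices H : tensorEval (tensorEval f g) h ∘ₗ (TensorProduct.lift m).lTensor (V ⊗[ℚ] W) ∘ₗ
      (TensorProduct.tensorTensorTensorComm ℚ V U W U).toLinearMap =
      tensorEval (tensorEval f h) (tensorEval g h) from
        (LinearMap.congr_fun H (s ⊗ₜ s')).trans (tensorEval_tmul _ _ _ _)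
    ext a b c d
    simp [tensorEval_tmul, hh, mul_mul_mul_comm]
  suffices H : tensorEval (tensorEval f g) h ∘ₗ tensorCoaction m ρV ρW =
    tensorEval (tensorEval f h ∘ₗ ρV) (tensorEval g h ∘ₗ ρW) from LinearMap.congr_fun H t
  ext v w
  simp [tensorEval_tmul, tensorCoaction, key]

end TensorEval

section Structure

variable {I J I' J' : Type} [LinearOrder I] [Fintype I] [LinearOrder J] [Fintype J]
  [LinearOrder I'] [Fintype I'] [LinearOrder J'] [Fintype J']

theorem tensorEval_comp_δ (x : I → J → ℚ) (y : I' → J' → ℚ) :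
    tensorEval (realize x) (realize y) ∘ₗ δ = realize (lexMul x y) :=
  LinearMap.ext (tensorEval_δ x y)

theorem tensorEval_comp_Δ (x : I → J → ℚ) (y : I' → J' → ℚ) :
    tensorEval (realize x) (realize y) ∘ₗ Δ = realize (lexAdd x y) :=
  LinearMap.ext (tensorEval_Δ x y)

theorem realize_comp_lift_qsh (x : I → J → ℚ) :
    realize x ∘ₗ TensorProduct.lift qsh = tensorEval (realize x) (realize x) := by
  ext1
  refine LinearMap.ext fun a => LinearMap.ext fun b => ?_
  simp [tensorEval_tmul, realize_qsh]

theorem qsh_assoc (a b c : HPack) : qsh (qsh a b) c = qsh a (qsh b c) :=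
  isSeparating_realize _ _ fun x => by simp only [realize_qsh, mul_assoc]

theorem qsh_comm (a b : HPack) : qsh a b = qsh b a :=
  isSeparating_realize _ _ fun x => by simp only [realize_qsh, mul_comm]

theorem one_qsh (a : HPack) : qsh one a = a :=
  isSeparating_realize _ _ fun x => by simp only [realize_qsh, realize_one, one_mul]

theorem qsh_one (a : HPack) : qsh a one = a := by
  rw [qsh_comm, one_qsh]

theorem isCommBialgebra_δ : IsCommBialgebra qsh one δ εδ where
  mul_assoc := qsh_assoc
  mul_comm := qsh_comm
  one_mul := one_qsh
  mul_one := qsh_one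
  coassoc := LinearMap.ext fun a =>
    (isSeparating_realize.tensorEval (isSeparating_realize.tensorEval isSeparating_realize)) _ _
    fun ⟨x, y, z⟩ => by
      simp only [LinearMap.comp_apply, LinearEquiv.coe_coe, tensorEval_assoc, tensorEval_rTensor,
        tensorEval_lTensor, tensorEval_comp_δ, tensorEval_δ]
      refine LinearMap.congr_fun (realize_congr (Prod.Lex.prodLexAssoc _ _ _)
        (Prod.Lex.prodLexAssoc _ _ _) fun i j => ?_) a
      exact mul_assoc _ _ _
  counit_left a := (isSeparating_id.tensorEval isSeparating_realize) _ _ fun ⟨_, x⟩ => by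
    simp only [tensorEval_rTensor, LinearMap.id_comp, tensorEval_tmul, LinearMap.id_apply, one_mul]
    rw [← realize_unit, tensorEval_δ]
    exact LinearMap.congr_fun (realize_congr (Prod.Lex.uniqueProd _ _) (Prod.Lex.uniqueProd _ _)
      fun i j => one_mul (x.2 (ofLex i).2 (ofLex j).2)) a
  counit_right a := (isSeparating_realize.tensorEval isSeparating_id) _ _ fun ⟨x, _⟩ => by
    simp only [tensorEval_lTensor, LinearMap.id_comp, tensorEval_tmul, LinearMap.id_apply, mul_one]
    rw [← realize_unit, tensorEval_δ]
    exact LinearMap.congr_fun (realize_congr (Prod.Lex.prodUnique _ _) (Prod.Lex.prodUnique _ _)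
      fun i j => mul_one (x.2 (ofLex i).1 (ofLex j).1)) a
  comul_mul a b := (isSeparating_realize.tensorEval isSeparating_realize) _ _ fun ⟨x, y⟩ => by
    simp only [tensorEval_tensorMul (realize_qsh _) (realize_qsh _), tensorEval_δ, realize_qsh]
  comul_one := (isSeparating_realize.tensorEval isSeparating_realize) _ _ fun ⟨x, y⟩ => by
    simp only [tensorEval_δ, tensorEval_tmul, realize_one, mul_one]
  counit_mul a b := by rw [← realize_unit, realize_qsh]
  counit_one := by rw [← realize_unit, realize_one]

theorem isCommBialgebra_Δ : IsCommBialgebra qsh one Δ εΔ where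
  mul_assoc := qsh_assoc
  mul_comm := qsh_comm
  one_mul := one_qsh
  mul_one := qsh_one
  coassoc := LinearMap.ext fun a =>
    (isSeparating_realize.tensorEval (isSeparating_realize.tensorEval isSeparating_realize)) _ _
    fun ⟨x, y, z⟩ => by
      simp only [LinearMap.comp_apply, LinearEquiv.coe_coe, tensorEval_assoc, tensorEval_rTensor,
        tensorEval_lTensor, tensorEval_comp_Δ, tensorEval_Δ]
      refine LinearMap.congr_fun (realize_congr (OrderIso.sumLexAssoc _ _ _)
        (OrderIso.sumLexAssoc _ _ _) fun i j => ?_) a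
      rcases i with (i | i) | i <;> rcases j with (j | j) | j <;> rfl
  counit_left a := (isSeparating_id.tensorEval isSeparating_realize) _ _ fun ⟨_, x⟩ => by
    simp only [tensorEval_rTensor, LinearMap.id_comp, tensorEval_tmul, LinearMap.id_apply, one_mul]
    rw [← realize_of_isEmpty (fun (_ _ : Empty) => 0), tensorEval_Δ]
    refine LinearMap.congr_fun (realize_congr OrderIso.emptySumLex OrderIso.emptySumLex
      fun i j => ?_) a
    rcases i with i | i <;> rcases j with j | j <;> first | exact i.elim | exact j.elim | rfl
  counit_right a := (isSeparating_realize.tensorEval isSeparating_id) _ _ fun ⟨x, _⟩ => by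
    simp only [tensorEval_lTensor, LinearMap.id_comp, tensorEval_tmul, LinearMap.id_apply, mul_one]
    rw [← realize_of_isEmpty (fun (_ _ : Empty) => 0), tensorEval_Δ]
    refine LinearMap.congr_fun (realize_congr OrderIso.sumLexEmpty OrderIso.sumLexEmpty
      fun i j => ?_) a
    rcases i with i | i <;> rcases j with j | j <;> first | exact i.elim | exact j.elim | rfl
  comul_mul a b := (isSeparating_realize.tensorEval isSeparating_realize) _ _ fun ⟨x, y⟩ => by
    simp only [tensorEval_tensorMul (realize_qsh _) (realize_qsh _), tensorEval_Δ, realize_qsh]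
  comul_one := (isSeparating_realize.tensorEval isSeparating_realize) _ _ fun ⟨x, y⟩ => by
    simp only [tensorEval_Δ, tensorEval_tmul, realize_one, mul_one]
  counit_mul a b := by rw [← realize_of_isEmpty (fun (_ _ : Empty) => 0), realize_qsh]
  counit_one := by rw [← realize_of_isEmpty (fun (_ _ : Empty) => 0), realize_one]

theorem isComoduleHom_qsh :
    IsComoduleHom (tensorCoaction qsh δ δ) δ (TensorProduct.lift qsh) :=
  LinearMap.ext fun t => (isSeparating_realize.tensorEval isSeparating_realize) _ _ fun ⟨x, y⟩ => by
    simp only [LinearMap.comp_apply, tensorEval_rTensor, realize_comp_lift_qsh,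
      tensorEval_tensorCoaction δ δ _ _ (realize_qsh _), tensorEval_comp_δ, tensorEval_δ]
    rw [← realize_comp_lift_qsh, LinearMap.comp_apply]

theorem isComoduleHom_one :
    IsComoduleHom (unitCoaction one) δ (LinearMap.toSpanSingleton ℚ HPack one) := by
  refine LinearMap.ext_ring ?_
  simp [unitCoaction, isCommBialgebra_δ.comul_one]

theorem isComoduleHom_Δ : IsComoduleHom δ (tensorCoaction qsh δ δ) Δ :=
  LinearMap.ext fun a =>
    ((isSeparating_realize.tensorEval isSeparating_realize).tensorEval isSeparating_realize) _ _
    fun ⟨⟨x, y⟩, z⟩ => by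
      simp only [LinearMap.comp_apply, tensorEval_rTensor,
        tensorEval_tensorCoaction δ δ _ _ (realize_qsh _), tensorEval_comp_δ, tensorEval_comp_Δ,
        tensorEval_δ, tensorEval_Δ]
      refine LinearMap.congr_fun (realize_congr (Prod.Lex.sumLexProdLexDistrib _ _ _)
        (Prod.Lex.sumLexProdLexDistrib _ _ _) fun i j => ?_) a
      rcases i with ⟨i | i, i'⟩ <;> rcases j with ⟨j | j, j'⟩ <;>
        first | rfl | exact zero_mul _

theorem isComoduleHom_εΔ : IsComoduleHom δ (unitCoaction one) εΔ :=
  LinearMap.ext fun a => (isSeparating_id.tensorEval isSeparating_realize) _ _ fun ⟨_, x⟩ => by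
    have : IsEmpty (Empty ×ₗ Fin x.1.1) := inferInstanceAs (IsEmpty (Empty × Fin x.1.1))
    have : IsEmpty (Empty ×ₗ Fin x.1.2) := inferInstanceAs (IsEmpty (Empty × Fin x.1.2))
    simp only [LinearMap.comp_apply, tensorEval_rTensor, LinearMap.id_comp, unitCoaction,
      LinearMap.flip_apply, TensorProduct.mk_apply, tensorEval_tmul, LinearMap.id_apply,
      realize_one, mul_one]
    rw [← realize_of_isEmpty (fun (_ _ : Empty) => 0), tensorEval_δ, realize_of_isEmpty,
      realize_of_isEmpty]

end Structure

end HPack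

/-- `(H_Pack, ⧢, Δ, δ)` is a commutative double bialgebra, with unit the empty matrix and with
counits `εΔ` of `Δ` and `εδ` of `δ`. -/
theorem mainTheorem1 :
    IsDoubleBialgebra (R := ℚ) (A := HPack)
      HPack.qsh HPack.one HPack.Δ HPack.εΔ HPack.δ HPack.εδ where
  bialgebra_δ := HPack.isCommBialgebra_δ
  bialgebra_Δ := HPack.isCommBialgebra_Δ
  mul_comodule := HPack.isComoduleHom_qsh
  unit_comodule := HPack.isComoduleHom_one
  comul_comodule := HPack.isComoduleHom_Δ
  counit_comodule := HPack.isComoduleHom_εΔ
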